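/- Let $\Gamma$ be a finitely generated group with a finite generating set $S$. For a subgroup $\Lambda\le\Gamma$ let $\mathrm{Sch}(\Gamma,\Lambda,S)$ be the Schreier graph: its vertices are the right cosets $\Lambda g$ ($g\in\Gamma$), and for each vertex $\Lambda g$ and each $s\in S$ there is a directed edge labelled $s$ from $\Lambda g$ to $\Lambda gs$; write $\mathrm{Cay}(\Gamma,S)=\mathrm{Sch}(\Gamma,\{1\},S)$. Distances, balls and connected components in such graphs are taken ignoring the directions of the edges. Let $(N_k)_{k\in\mathbb N}$ be a Farber sequence in $\Gamma$, i.e. a sequence of finite-index subgroups (not necessarily normal or nested) such that, with $G_k=\mathrm{Sch}(\Gamma,N_k,S)$, for every $r\in\mathbb N$ the proportion of vertices $x$ of $G_k$ whose ball $B_r(G_k,x)$ is isomorphic, as a rooted directed $S$-labelled graph, to $B_r(\mathrm{Cay}(\Gamma,S),1)$ tends to $1$ as $k\to\infty$. Let $\mathcal G=(G_k)_{k\in\mathbb N}$. Then the following are equivalent: 1. $\Gamma$ is amenable, i.e. for every finite $A\subset\Gamma$ and every $\varepsilon>0$ there is a nonempty finite $F\subset\Gamma$ with $|gF\,\triangle\,F|<\varepsilon|F|$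 for all $g\in A$. 2. $\mathcal G$ has property A, i.e. for every $\varepsilon>0$ there are $R>0$ and a map $x\mapsto\xi_x$ from the vertex set $V=\bigsqcup_k V(G_k)$ to $\ell^1(V)$ such that $\|\xi_x\|_1=1$ for all $x\in V$, each $\xi_x$ is supported in the ball of radius $R$ about $x$ in the graph containing $x$, and $\|\xi_x-\xi_y\|_1<\varepsilon$ whenever there is an edge from $x$ to $y$. 3. $\mathcal G$ is hyperfinite, i.e. for every $\varepsilon>0$ there are a constant $K>0$ and sets of edges $E_k\subset E(G_k)$ $(k\in\mathbb N)$ such that $\lim_{k\to\infty}|E_k|/|V(G_k)|$ exists and is less than $\varepsilon$, and for every $k$ all connected components of $G_k\setminus E_k$ have at most $K$ vertices. -/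

import Mathlib

namespace FarberElek

open Filter Topology
open scoped Pointwise symmDiff

/-- A directed graph with vertex set `V` whose edges carry labels in `L`: `G.Adj s x y` says that
there is an edge from `x` to `y` with label `s`. Loops, and several edges with different labels
between the same two vertices, are allowed. -/
structure LabelledGraph (V L : Type*) where
  Adj : L → V → V → Prop

namespace LabelledGraph

variable {V W L : Type*}

/-- The set of edges, an edge being a triple (source, label, target). -/
def edgeSet (G : LabelledGraph V L) : Set (V × L × V) :=
  {e | G.Adj e.2.1 e.1 e.2.2}

/-- The underlying undirected simple graph, obtained by forgetting directions, labels and loops.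
It carries the path metric and the connected components of `G`. -/
def toSimpleGraph (G : LabelledGraph V L) : SimpleGraph V :=
  SimpleGraph.fromRel fun x y => ∃ s, G.Adj s x y

/-- The graph on the same vertices from which the edges in `E` have been removed. -/
def deleteEdges (G : LabelledGraph V L) (E : Set (V × L × V)) : LabelledGraph V L where
  Adj s x y := G.Adj s x y ∧ (x, s, y) ∉ E

/-- The closed ball of radius `r` around `x` in the (extended) path metric, which does not see
the directions of the edges. -/
def ball (G : LabelledGraph V L) (x : V) (r : ℕ) : Set V :=
  {y | G.toSimpleGraph.edist x y ≤ r}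

theorem mem_ball_self (G : LabelledGraph V L) (x : V) (r : ℕ) : x ∈ G.ball x r := by
  simp [ball]

/-- `B_r(G, x) ≃ B_r(H, y)` as rooted labelled directed graphs, where the balls carry the induced
subgraph structure and the roots are their centres. -/
def BallIso (G : LabelledGraph V L) (x : V) (H : LabelledGraph W L) (y : W) (r : ℕ) : Prop :=
  ∃ e : G.ball x r ≃ H.ball y r,
    e ⟨x, G.mem_ball_self x r⟩ = ⟨y, H.mem_ball_self y r⟩ ∧
    ∀ (s : L) (a b : G.ball x r), G.Adj s a b ↔ H.Adj s (e a) (e b)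

/-- For a finite graph `G`: the probability that the `r`-ball around a uniformly chosen vertex of
`G` is isomorphic to `B_r(H, o)`. -/
noncomputable def ballProb (G : LabelledGraph V L) (H : LabelledGraph W L) (o : W) (r : ℕ) : ℝ :=
  (Nat.card {x : V // BallIso G x H o r} : ℝ) / (Nat.card V : ℝ)

/-- The disjoint union of a sequence of labelled graphs. Different members of the sequence lie at
infinite distance from each other. -/
def disjointUnion {V : ℕ → Type*} (G : ∀ n, LabelledGraph (V n) L) :
    LabelledGraph (Σ n, V n) L where
  Adj s x y := ∃ (n : ℕ) (a b : V n), x = ⟨n, a⟩ ∧ y = ⟨n, b⟩ ∧ (G n).Adj s a b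

end LabelledGraph

open LabelledGraph

/-- Benjamini-Schramm convergence of a sequence of finite labelled graphs to the graph `H` rooted
at `o` (used for a Cayley graph `H`, all of whose vertices look alike). -/
def BenjaminiSchrammTendsto {V : ℕ → Type*} {W L : Type*} (G : ∀ n, LabelledGraph (V n) L)
    (H : LabelledGraph W L) (o : W) : Prop :=
  ∀ r : ℕ, Tendsto (fun n => ballProb (G n) H o r) atTop (𝓝 1)

/-- Property A of a sequence of graphs: for every `ε > 0` there are a radius `R` and a map
`x ↦ ξ x` from the vertices of the disjoint union to its `ℓ¹`-space, such that all `ξ x` have norm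
one, `ξ x` is supported in the `R`-ball about `x`, and `ξ` varies by less than `ε` along edges. -/
def HasPropertyA {V : ℕ → Type*} {L : Type*} (G : ∀ n, LabelledGraph (V n) L) : Prop :=
  ∀ ε : ℝ, 0 < ε → ∃ R : ℕ, 0 < R ∧
    ∃ ξ : (Σ n, V n) → lp (fun _ : (Σ n, V n) => ℝ) 1,
      (∀ x, ‖ξ x‖ = 1) ∧
      (∀ x z, ξ x z ≠ 0 → z ∈ (disjointUnion G).ball x R) ∧
      ∀ s x y, (disjointUnion G).Adj s x y → ‖ξ x - ξ y‖ < ε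

/-- Hyperfiniteness of a sequence of finite graphs: for every `ε > 0` one can remove edge sets
`E n`, with `lim |E n| / |V n|` existing and smaller than `ε`, so that all the remaining connected
components have at most `K` vertices, where `K` does not depend on `n`. -/
def IsHyperfinite {V : ℕ → Type*} {L : Type*} (G : ∀ n, LabelledGraph (V n) L) : Prop :=
  ∀ ε : ℝ, 0 < ε → ∃ K : ℕ, 0 < K ∧ ∃ E : ∀ n, Set (V n × L × V n),
    (∀ n, E n ⊆ (G n).edgeSet) ∧
    (∃ l : ℝ, l < ε ∧
      Tendsto (fun n => ((E n).ncard : ℝ) / (Nat.card (V n) : ℝ)) atTop (𝓝 l)) ∧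
    ∀ (n : ℕ) (C : ((G n).deleteEdges (E n)).toSimpleGraph.ConnectedComponent),
      C.supp.encard ≤ K

/-- Amenability of a (discrete) group, in the sense of Følner: for every finite `A ⊆ Γ` and every
`ε > 0` there is a nonempty finite `F ⊆ Γ` with `|gF ∆ F| < ε |F|` for all `g ∈ A`. -/
def IsAmenable (Γ : Type*) [Group Γ] : Prop :=
  ∀ (A : Finset Γ) (ε : ℝ), 0 < ε → ∃ F : Finset Γ, F.Nonempty ∧
    ∀ g ∈ A, (((g • (F : Set Γ)) ∆ (F : Set Γ)).ncard : ℝ) < ε * (F.card : ℝ)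

section Schreier

variable {Γ : Type*} [Group Γ]

/-- The set `Λ \ Γ` of right cosets `Λ g`. -/
abbrev RightCosets (Λ : Subgroup Γ) : Type _ :=
  Quotient (QuotientGroup.rightRel Λ)

/-- The right coset `Λ g`. -/
def rightCoset (Λ : Subgroup Γ) (g : Γ) : RightCosets Λ :=
  Quotient.mk (QuotientGroup.rightRel Λ) g

/-- Two elements define the same point of `Λ \ Γ` exactly if `Λ g = Λ h` as subsets of `Γ`. -/
theorem rightCoset_eq_iff (Λ : Subgroup Γ) (g h : Γ) :
    rightCoset Λ g = rightCoset Λ h ↔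
      {x | ∃ a ∈ Λ, x = a * g} = {x | ∃ a ∈ Λ, x = a * h} := by
  rw [rightCoset, rightCoset, Quotient.eq, QuotientGroup.rightRel_apply]
  constructor
  · intro hgh
    ext x
    constructor
    · rintro ⟨a, ha, rfl⟩
      exact ⟨a * (h * g⁻¹)⁻¹, Λ.mul_mem ha (Λ.inv_mem hgh), by group⟩
    · rintro ⟨a, ha, rfl⟩
      exact ⟨a * (h * g⁻¹), Λ.mul_mem ha hgh, by group⟩
  · intro hgh
    have hh : h ∈ {x | ∃ a ∈ Λ, x = a * g} := by
      rw [hgh]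
      exact ⟨1, Λ.one_mem, by simp⟩
    obtain ⟨a, ha, rfl⟩ := hh
    simpa using ha

/-- The Schreier graph `Sch(Γ, Λ, S)`: its vertices are the right cosets of `Λ`, and there is an
edge with label `s ∈ S` from `Λ g` to `Λ g s`. -/
def schreierGraph (Λ : Subgroup Γ) (S : Set Γ) : LabelledGraph (RightCosets Λ) S where
  Adj s x y := ∃ g : Γ, x = rightCoset Λ g ∧ y = rightCoset Λ (g * (s : Γ))

/-- The Cayley graph `Cay(Γ, S)`, with an edge labelled `s ∈ S` from `g` to `g s`. -/
def cayleyGraph (S : Set Γ) : LabelledGraph Γ S where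
  Adj s x y := y = x * (s : Γ)

/-- `N` is a Farber sequence of `Γ` (with respect to the generating set `S`): all `N k` have finite
index, and the Schreier graphs converge to the Cayley graph in the sense of Benjamini-Schramm. -/
def IsFarberSequence (S : Set Γ) (N : ℕ → Subgroup Γ) : Prop :=
  (∀ k, (N k).FiniteIndex) ∧
    BenjaminiSchrammTendsto (fun k => schreierGraph (N k) S) (cayleyGraph S) 1

end Schreier

end FarberElek

/-! The implications run in a cycle. Amenability gives property A by transport: push the uniform
measure on a Følner set `F` to the Schreier graph along `w ↦ x * w`. Moving `x` along an edge
labelled `s` replaces `F` by `s • F`, which changes the measure little. Property A gives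
hyperfiniteness by a coarea argument. For fixed `z`, the function `x ↦ ‖ξ x z‖` has support of size
bounded uniformly in `z` and `k`. Summed over `z`, these functions have small total variation
compared with their mass, also inside any vertex set `X`. Hence some level set is a bounded piece of
`X` with small relative boundary (`exists_small_relBoundary`). Cutting off such pieces until nothing
is left gives the partition (`exists_partition_of_small_relBoundary`). Hyperfiniteness gives
amenability by averaging (`exists_class_card_edges_le`): some component of size at most `K` has few
removed edges and contains a vertex whose `K`-ball looks like the Cayley ball. The ball isomorphism
copies this component to a Følner set in `Γ`. -/

namespace FarberElek

open Filter Topology LabelledGraph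
open scoped Pointwise symmDiff

/-! ### Coarea inequality and greedy partitions of finite graphs. -/

section Isoperimetry

variable {V L : Type*}

open Classical in
/-- The edges in `E` with both endpoints in `X`, exactly one of which lies in `B`. -/
noncomputable def relBoundary (E : Finset (V × L × V)) (X B : Finset V) : Finset (V × L × V) :=
  {e ∈ E | (e.1 ∈ X ∧ e.2.2 ∈ X) ∧ ¬ (e.1 ∈ B ↔ e.2.2 ∈ B)}

open Classical in
/-- Discrete coarea inequality: an isoperimetric inequality for all sets on which `f` is positive
bounds the total mass of `f` by its total variation. -/
theorem mul_sum_le_sum_abs_sub_of_isoperimetric (E : Finset (V × L × V)) (X : Finset V) (c : ℝ)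
    (f : V → ℝ) (hf : ∀ x, 0 ≤ f x)
    (h : ∀ B ⊆ X, B.Nonempty → (∀ x ∈ B, 0 < f x) →
      c * (B.card : ℝ) ≤ ((relBoundary E X B).card : ℝ)) :
    c * ∑ x ∈ X, f x ≤ ∑ e ∈ E with (e.1 ∈ X ∧ e.2.2 ∈ X), |f e.1 - f e.2.2| := by
  induction hn : (X.filter fun x => 0 < f x).card using Nat.strong_induction_on generalizing f with
  | _ n ih =>
  set B := X.filter fun x => 0 < f x with hB
  rcases B.eq_empty_or_nonempty with hBe | hBne
  · have h0 : ∑ x ∈ X, f x = 0 := by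
      refine Finset.sum_eq_zero fun x hx => le_antisymm ?_ (hf x)
      by_contra hlt
      have : x ∈ B := by simp [hB, hx, not_le.1 hlt]
      simp [hBe] at this
    rw [h0, mul_zero]
    exact Finset.sum_nonneg fun _ _ => abs_nonneg _
  · obtain ⟨m, hmB, hm⟩ := Finset.exists_min_image B f hBne
    have hmpos : 0 < f m := (Finset.mem_filter.1 hmB).2
    have hBX : B ⊆ X := Finset.filter_subset _ _
    -- Peel off the lowest level: subtracting the minimum on `B` removes `m` from the support, while
    -- the mass drops by `f m * |B|` and the variation by `f m` times the relative boundary of `B`.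
    set f' : V → ℝ := fun x => if x ∈ B then f x - f m else f x with hf'
    have hf'nn : ∀ x, 0 ≤ f' x := by
      intro x
      simp only [hf']
      split_ifs with hx
      · linarith [hm x hx]
      · exact hf x
    have hle : ∀ x, f' x ≤ f x := by
      intro x
      simp only [hf']
      split_ifs <;> linarith
    have hlt : (X.filter fun x => 0 < f' x).card < n := by
      rw [← hn]
      refine Finset.card_lt_card ⟨fun x hx => ?_, fun hsub => ?_⟩
      · rw [Finset.mem_filter] at hx
        exact Finset.mem_filter.2 ⟨hx.1, hx.2.trans_le (hle x)⟩
      · have := (Finset.mem_filter.1 (hsub hmB)).2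
        simp [hf', hmB] at this
    have key := ih _ hlt f' hf'nn
      (fun C hC hCne hCpos => h C hC hCne fun x hx => (hCpos x hx).trans_le (hle x)) rfl
    have hsum : ∑ x ∈ X, f x = f m * B.card + ∑ x ∈ X, f' x := by
      have : ∀ x ∈ X, f x = (if x ∈ B then f m else 0) + f' x := by
        intro x _
        simp only [hf']
        split_ifs <;> ring
      rw [Finset.sum_congr rfl this, Finset.sum_add_distrib, ← Finset.sum_filter,
        Finset.sum_const, nsmul_eq_mul, Finset.filter_mem_eq_inter,
        Finset.inter_eq_right.2 hBX, mul_comm]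
    have hout : ∀ x ∈ X, x ∉ B → f x = 0 := by
      intro x hx hxB
      refine le_antisymm ?_ (hf x)
      by_contra hlt
      exact hxB (Finset.mem_filter.2 ⟨hx, not_le.1 hlt⟩)
    have htv : ∑ e ∈ E with (e.1 ∈ X ∧ e.2.2 ∈ X), |f e.1 - f e.2.2| =
        f m * (relBoundary E X B).card +
          ∑ e ∈ E with (e.1 ∈ X ∧ e.2.2 ∈ X), |f' e.1 - f' e.2.2| := by
      have : ∀ e ∈ E.filter (fun e => e.1 ∈ X ∧ e.2.2 ∈ X), |f e.1 - f e.2.2| =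
          (if ¬ (e.1 ∈ B ↔ e.2.2 ∈ B) then f m else 0) + |f' e.1 - f' e.2.2| := by
        intro e he
        obtain ⟨-, h1, h2⟩ := Finset.mem_filter.1 he
        by_cases hb1 : e.1 ∈ B <;> by_cases hb2 : e.2.2 ∈ B
        · simp [hf', hb1, hb2]
        · have := hm _ hb1
          simp only [hf', hb1, hb2, hout _ h2 hb2, if_true, if_false, iff_false, not_true,
            not_false_eq_true]
          rw [abs_of_nonneg, abs_of_nonneg] <;> linarith
        · have := hm _ hb2
          simp only [hf', hb1, hb2, hout _ h1 hb1, if_true, if_false, iff_true,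
            not_false_eq_true]
          rw [abs_of_nonpos, abs_of_nonpos] <;> linarith
        · simp [hf', hb1, hb2]
      rw [Finset.sum_congr rfl this, Finset.sum_add_distrib, ← Finset.sum_filter,
        Finset.sum_const, nsmul_eq_mul, Finset.filter_filter, mul_comm]
      rfl
    have hBb := h B hBX hBne fun x hx => (Finset.mem_filter.1 hx).2
    rw [hsum, htv]
    nlinarith [mul_le_mul_of_nonneg_left hBb hmpos.le]

open Classical in
/-- A family of almost invariant probability vectors with uniformly small supports yields, inside
every finite set `X`, a nonempty set of bounded size with small boundary relative to `X`. -/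
theorem exists_small_relBoundary [Fintype V] (E : Finset (V × L × V)) {K : ℕ} {c d δ : ℝ}
    (hδ : 0 ≤ δ) (hc : d * δ < c) (f : V → V → ℝ) (hf : ∀ x z, 0 ≤ f x z)
    (hf1 : ∀ x, ∑ z, f x z = 1)
    (hfE : ∀ e ∈ E, ∑ z, |f e.1 z - f e.2.2 z| ≤ δ)
    (hfK : ∀ z, (Finset.univ.filter fun x => f x z ≠ 0).card ≤ K)
    {X : Finset V} (hX : X.Nonempty)
    (hd : ((E.filter fun e => e.1 ∈ X).card : ℝ) ≤ d * X.card) :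
    ∃ B ⊆ X, B.Nonempty ∧ B.card ≤ K ∧ ((relBoundary E X B).card : ℝ) ≤ c * B.card := by
  by_contra! hcon
  -- Slice by the second variable: `x ↦ f x z` has at most `K` points in its support, so the assumed
  -- failure supplies the isoperimetric hypothesis. Summing over `z` then gives `c * |X| ≤ d * δ *
  -- |X|`, a contradiction.
  have hz : ∀ z, c * ∑ x ∈ X, f x z ≤
      ∑ e ∈ E with (e.1 ∈ X ∧ e.2.2 ∈ X), |f e.1 z - f e.2.2 z| := by
    intro z
    refine mul_sum_le_sum_abs_sub_of_isoperimetric E X c (fun x => f x z) (fun x => hf x z) ?_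
    intro B hBX hBne hpos
    refine (hcon B hBX hBne ((Finset.card_le_card fun x hx => ?_).trans (hfK z))).le
    exact Finset.mem_filter.2 ⟨Finset.mem_univ _, (hpos x hx).ne'⟩
  have hsum := Finset.sum_le_sum fun z (_ : z ∈ Finset.univ) => hz z
  rw [← Finset.mul_sum, Finset.sum_comm, Finset.sum_comm (s := Finset.univ)] at hsum
  simp only [hf1, Finset.sum_const, nsmul_eq_mul, mul_one] at hsum
  have h1 : ∑ e ∈ E with (e.1 ∈ X ∧ e.2.2 ∈ X), ∑ z, |f e.1 z - f e.2.2 z| ≤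
      ((E.filter fun e => e.1 ∈ X).card : ℝ) * δ := by
    refine (Finset.sum_le_card_nsmul _ _ δ fun e he =>
      hfE e (Finset.mem_filter.1 he).1).trans ?_
    rw [nsmul_eq_mul]
    refine mul_le_mul_of_nonneg_right ?_ hδ
    exact_mod_cast Finset.card_le_card fun e he => by
      rw [Finset.mem_filter] at he ⊢
      exact ⟨he.1, he.2.1⟩
  have hXpos : (0 : ℝ) < X.card := by exact_mod_cast hX.card_pos
  nlinarith [mul_le_mul_of_nonneg_right hd hδ, mul_lt_mul_of_pos_right hc hXpos]

open Classical in
/-- If every nonempty finite set contains a nonempty subset of size at most `K` with small relative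
boundary, then finite sets can be partitioned into pieces of size at most `K` by removing few
edges. -/
theorem exists_partition_of_small_relBoundary (E : Finset (V × L × V)) (K : ℕ) (c : ℝ)
    (h : ∀ X : Finset V, X.Nonempty → ∃ B ⊆ X, B.Nonempty ∧ B.card ≤ K ∧
      ((relBoundary E X B).card : ℝ) ≤ c * B.card) (X : Finset V) :
    ∃ D ⊆ E, (D.card : ℝ) ≤ c * X.card ∧ ∃ p : V → Finset V,
      (∀ x ∈ X, x ∈ p x ∧ p x ⊆ X ∧ (p x).card ≤ K) ∧
      ∀ e ∈ E, e ∉ D → e.1 ∈ X → e.2.2 ∈ X → p e.1 = p e.2.2 := by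
  induction X using Finset.strongInduction with
  | H X ih =>
  rcases X.eq_empty_or_nonempty with rfl | hX
  · exact ⟨∅, by simp, by simp, fun _ => ∅, by simp, by simp⟩
  obtain ⟨B, hBX, hBne, hBK, hB⟩ := h X hX
  -- Each piece pays only for its boundary relative to what is left, at cost `c` per vertex, so the
  -- costs add up to `c * |X|`.
  obtain ⟨D, hDE, hD, p, hp, hpe⟩ := ih (X \ B) (Finset.sdiff_ssubset hBX hBne)
  refine ⟨D ∪ relBoundary E X B, Finset.union_subset hDE (Finset.filter_subset _ _), ?_,
    fun x => if x ∈ B then B else p x, ?_, ?_⟩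
  · have h1 : ((D ∪ relBoundary E X B).card : ℝ) ≤ D.card + (relBoundary E X B).card := by
      exact_mod_cast Finset.card_union_le _ _
    have h2 : ((X \ B).card : ℝ) + B.card = X.card := by
      exact_mod_cast Finset.card_sdiff_add_card_eq_card hBX
    calc _ ≤ _ := h1
      _ ≤ c * (X \ B).card + c * B.card := add_le_add hD hB
      _ = c * X.card := by rw [← mul_add, h2]
  · intro x hx
    by_cases hxB : x ∈ B
    · simp [hxB, hBX, hBK]
    · obtain ⟨h1, h2, h3⟩ := hp x (by simp [hx, hxB])
      simp only [hxB, if_false]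
      exact ⟨h1, h2.trans Finset.sdiff_subset, h3⟩
  · intro e he heD h1 h2
    rw [Finset.mem_union, not_or] at heD
    have hiff : e.1 ∈ B ↔ e.2.2 ∈ B := by
      by_contra hne
      exact heD.2 (Finset.mem_filter.2 ⟨he, ⟨h1, h2⟩, hne⟩)
    by_cases hb : e.1 ∈ B
    · simp [hb, hiff.1 hb]
    · have hb' : e.2.2 ∉ B := fun h' => hb (hiff.2 h')
      simp only [hb, hb', if_false]
      exact hpe e he heD.1 (by simp [h1, hb]) (by simp [h2, hb'])

end Isoperimetry

/-! ### The right action on cosets and balls in Schreier graphs. -/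

section CosetAction

variable {Γ : Type*} [Group Γ]

/-- The right action of `Γ` on `Λ \ Γ`. -/
def cosetMul (Λ : Subgroup Γ) (x : RightCosets Λ) (w : Γ) : RightCosets Λ :=
  Quotient.map (· * w) (fun a b hab => by
    change QuotientGroup.rightRel Λ _ _ at hab
    change QuotientGroup.rightRel Λ _ _
    rw [QuotientGroup.rightRel_apply] at hab ⊢
    simpa [mul_assoc] using hab) x

theorem cosetMul_rightCoset (Λ : Subgroup Γ) (g w : Γ) :
    cosetMul Λ (rightCoset Λ g) w = rightCoset Λ (g * w) := rfl

theorem cosetMul_one (Λ : Subgroup Γ) (x : RightCosets Λ) : cosetMul Λ x 1 = x := by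
  induction x using Quotient.inductionOn with
  | h g => exact (cosetMul_rightCoset Λ g 1).trans (by rw [mul_one]; rfl)

theorem cosetMul_mul (Λ : Subgroup Γ) (x : RightCosets Λ) (v w : Γ) :
    cosetMul Λ x (v * w) = cosetMul Λ (cosetMul Λ x v) w := by
  induction x using Quotient.inductionOn with
  | h g => exact congrArg (rightCoset Λ) (mul_assoc g v w).symm

theorem schreierGraph_adj_iff (Λ : Subgroup Γ) (S : Set Γ) (s : S) (x y : RightCosets Λ) :
    (schreierGraph Λ S).Adj s x y ↔ y = cosetMul Λ x s := by
  constructor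
  · rintro ⟨g, rfl, rfl⟩
    rfl
  · rintro rfl
    induction x using Quotient.inductionOn with
    | h g => exact ⟨g, rfl, rfl⟩

theorem disjointUnion_schreierGraph_adj_iff (N : ℕ → Subgroup Γ) (S : Set Γ) (s : S)
    (x y : Σ k, RightCosets (N k)) :
    (disjointUnion fun k => schreierGraph (N k) S).Adj s x y ↔
      y = ⟨x.1, cosetMul (N x.1) x.2 s⟩ := by
  constructor
  · rintro ⟨k, a, b, rfl, rfl, h⟩
    rw [(schreierGraph_adj_iff _ _ _ _ _).1 h]
  · rintro rfl
    exact ⟨x.1, x.2, _, rfl, rfl, (schreierGraph_adj_iff _ _ _ _ _).2 rfl⟩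

/-- If generators move points by at most `1`, then every group element has bounded displacement. -/
theorem exists_edist_le {V : Type*} (G : SimpleGraph V) (S : Set Γ)
    (hS : Subgroup.closure S = ⊤) (a : V → Γ → V) (a_one : ∀ x, a x 1 = x)
    (a_mul : ∀ x g h, a x (g * h) = a (a x g) h) (ha : ∀ s ∈ S, ∀ x, G.edist x (a x s) ≤ 1)
    (w : Γ) : ∃ r : ℕ, ∀ x, G.edist x (a x w) ≤ r := by
  have hw : w ∈ Subgroup.closure S := hS ▸ Subgroup.mem_top w
  induction hw using Subgroup.closure_induction with
  | mem s hs => exact ⟨1, by simpa using ha s hs⟩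
  | one => exact ⟨0, by simp [a_one]⟩
  | mul g h _ _ ihg ihh =>
    obtain ⟨r, hr⟩ := ihg
    obtain ⟨t, ht⟩ := ihh
    refine ⟨r + t, fun x => ?_⟩
    rw [a_mul, Nat.cast_add]
    exact G.edist_triangle.trans (add_le_add (hr x) (ht _))
  | inv g _ ih =>
    obtain ⟨r, hr⟩ := ih
    refine ⟨r, fun x => ?_⟩
    have := hr (a x g⁻¹)
    rwa [← a_mul, inv_mul_cancel, a_one, SimpleGraph.edist_comm] at this

theorem edist_le_one_of_adj {V L : Type*} (G : LabelledGraph V L) {s : L} {x y : V}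
    (h : G.Adj s x y) : G.toSimpleGraph.edist x y ≤ 1 := by
  by_cases hxy : x = y
  · simp [hxy]
  · exact (SimpleGraph.edist_eq_one_iff_adj.2 
      ((SimpleGraph.fromRel_adj _ _ _).2 ⟨hxy, Or.inl ⟨s, h⟩⟩)).le

theorem exists_edist_cayleyGraph_le (S : Set Γ) (hS : Subgroup.closure S = ⊤) (w : Γ) :
    ∃ r : ℕ, (cayleyGraph S).toSimpleGraph.edist 1 w ≤ r := by
  obtain ⟨r, hr⟩ := exists_edist_le (cayleyGraph S).toSimpleGraph S hS (· * ·) mul_one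
    (fun x g h => (mul_assoc x g h).symm)
    (fun s hs x => edist_le_one_of_adj (cayleyGraph S) (s := ⟨s, hs⟩) rfl) w
  exact ⟨r, by simpa using hr 1⟩

theorem exists_forall_mem_ball_disjointUnion (N : ℕ → Subgroup Γ) (S : Set Γ)
    (hS : Subgroup.closure S = ⊤) (F : Finset Γ) :
    ∃ R : ℕ, 0 < R ∧ ∀ w ∈ F, ∀ x : Σ k, RightCosets (N k),
      (⟨x.1, cosetMul (N x.1) x.2 w⟩ : Σ k, RightCosets (N k)) ∈
        (disjointUnion fun k => schreierGraph (N k) S).ball x R := by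
  have key := exists_edist_le (disjointUnion fun k => schreierGraph (N k) S).toSimpleGraph S hS
    (fun x w => (⟨x.1, cosetMul (N x.1) x.2 w⟩ : Σ k, RightCosets (N k))) (fun x => by simp [cosetMul_one])
    (fun x g h => by simp [cosetMul_mul])
    (fun s hs x => edist_le_one_of_adj _ (s := ⟨s, hs⟩)
      ((disjointUnion_schreierGraph_adj_iff N S ⟨s, hs⟩ x _).2 rfl))
  choose r hr using key
  refine ⟨F.sup r + 1, Nat.succ_pos _, fun w hw x => (hr w x).trans ?_⟩
  exact_mod_cast (Finset.le_sup (f := r) hw).trans (Nat.le_succ _)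

/-- Balls in Schreier graphs are covered by the translates of their centre under a finite set that
only depends on the radius. -/
theorem exists_finset_of_mem_ball_disjointUnion (N : ℕ → Subgroup Γ) {S : Set Γ}
    (hS : S.Finite) (R : ℕ) :
    ∃ T : Finset Γ, ∀ x y : Σ k, RightCosets (N k),
      y ∈ (disjointUnion fun k => schreierGraph (N k) S).ball x R →
        ∃ w ∈ T, y = ⟨x.1, cosetMul (N x.1) x.2 w⟩ := by
  classical
  suffices h : ∃ T : Finset Γ, ∀ (x y : Σ k, RightCosets (N k))
      (p : (disjointUnion fun k => schreierGraph (N k) S).toSimpleGraph.Walk x y),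
      p.length ≤ R → ∃ w ∈ T, y = ⟨x.1, cosetMul (N x.1) x.2 w⟩ by
    obtain ⟨T, hT⟩ := h
    refine ⟨T, fun x y hxy => ?_⟩
    have hreach := SimpleGraph.reachable_of_edist_ne_top
      (ne_top_of_le_ne_top (ENat.natCast_ne_top R) hxy)
    obtain ⟨p, hp⟩ := hreach.exists_walk_length_eq_edist
    refine hT x y p ?_
    have : (p.length : ℕ∞) ≤ R := hp ▸ hxy
    exact_mod_cast this
  induction R with
  | zero =>
    refine ⟨{1}, fun x y p hp => ⟨1, by simp, ?_⟩⟩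
    cases p with
    | nil => simp [cosetMul_one]
    | cons _ _ => simp at hp
  | succ n ih =>
    obtain ⟨T, hT⟩ := ih
    -- Inverses account for edges traversed backwards; the first step of the walk becomes the left
    -- factor, because the action is on the right.
    refine ⟨insert 1 ((hS.toFinset ∪ hS.toFinset⁻¹) * T), fun x y p hp => ?_⟩
    cases p with
    | nil => exact ⟨1, by simp, by simp [cosetMul_one]⟩
    | @cons _ u _ hadj q =>
      obtain ⟨w, hw, rfl⟩ := hT u y q (by simpa using hp)
      have hu : ∃ t ∈ hS.toFinset ∪ hS.toFinset⁻¹,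
          u = ⟨x.1, cosetMul (N x.1) x.2 t⟩ := by
        obtain ⟨-, ⟨s, hs⟩ | ⟨s, hs⟩⟩ := hadj
        · exact ⟨s, by simp, (disjointUnion_schreierGraph_adj_iff _ _ _ _ _).1 hs⟩
        · refine ⟨(s : Γ)⁻¹, by simp, ?_⟩
          rw [disjointUnion_schreierGraph_adj_iff] at hs
          subst hs
          simp [← cosetMul_mul, cosetMul_one]
      obtain ⟨t, ht, rfl⟩ := hu
      exact ⟨t * w, Finset.mem_insert_of_mem (Finset.mul_mem_mul ht hw), by
        simp [cosetMul_mul]⟩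

end CosetAction

/-! ### From Følner sets to property A. -/

section PropertyA

variable {ι : Type*}

theorem hasSum_norm_lp_one (f : lp (fun _ : ι => ℝ) 1) : HasSum (fun z => ‖f z‖) ‖f‖ := by
  simpa using lp.hasSum_norm (p := 1) (by simp) f

/-- The map `u` need not be injective: masses landing on the same point add without cancellation,
since they are nonnegative. -/
theorem norm_sum_single_eq_one [DecidableEq ι] {α : Type*} {F : Finset α} (hF : F.Nonempty)
    (u : α → ι) :
    ‖∑ w ∈ F, lp.single (E := fun _ : ι => ℝ) 1 (u w) (F.card : ℝ)⁻¹‖ = 1 := by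
  refine (hasSum_norm_lp_one _).unique ?_
  have h : HasSum (fun z => ∑ w ∈ F, Pi.single (M := fun _ => ℝ) (u w) (F.card : ℝ)⁻¹ z)
      (∑ w ∈ F, (F.card : ℝ)⁻¹) :=
    hasSum_sum fun w _ => hasSum_pi_single (u w) _
  rw [Finset.sum_const, nsmul_eq_mul,
    mul_inv_cancel₀ (by exact_mod_cast hF.card_pos.ne')] at h
  convert h using 2 with z
  rw [lp.coeFn_sum, Finset.sum_apply, Real.norm_of_nonneg]
  · rfl
  · refine Finset.sum_nonneg fun w _ => ?_
    rw [lp.single_apply, Pi.single_apply]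
    split_ifs <;> positivity

theorem hasPropertyA_of_isAmenable {Γ : Type*} [Group Γ] {S : Set Γ} (hSfin : S.Finite)
    (hSgen : Subgroup.closure S = ⊤) (N : ℕ → Subgroup Γ) (hΓ : IsAmenable Γ) :
    HasPropertyA fun k => schreierGraph (N k) S := by
  classical
  intro ε hε
  obtain ⟨F, hFne, hF⟩ := hΓ hSfin.toFinset ε hε
  obtain ⟨R, hR, hball⟩ := exists_forall_mem_ball_disjointUnion N S hSgen F
  have hFpos : (0 : ℝ) < F.card := by exact_mod_cast hFne.card_pos
  refine ⟨R, hR, fun x => ∑ w ∈ F, lp.single 1 ⟨x.1, cosetMul (N x.1) x.2 w⟩ (F.card : ℝ)⁻¹,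
    fun x => norm_sum_single_eq_one hFne _, fun x z hz => ?_, fun s x y hxy => ?_⟩
  · rw [lp.coeFn_sum, Finset.sum_apply] at hz
    obtain ⟨w, hw, hwz⟩ := Finset.exists_ne_zero_of_sum_ne_zero hz
    have : z = ⟨x.1, cosetMul (N x.1) x.2 w⟩ := by
      by_contra hne
      exact hwz (lp.single_apply_ne 1 _ _ hne)
    rw [this]
    exact hball w hw x
  · rw [disjointUnion_schreierGraph_adj_iff] at hxy
    subst hxy
    set u : Γ → lp (fun _ : (Σ k, RightCosets (N k)) => ℝ) 1 := fun w =>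
      lp.single 1 ⟨x.1, cosetMul (N x.1) x.2 w⟩ (F.card : ℝ)⁻¹ with hu
    have hu1 : ∀ w, ‖u w‖ ≤ (F.card : ℝ)⁻¹ := fun w => by
      rw [hu, lp.norm_single (by simp), Real.norm_of_nonneg (by positivity)]
    have hshift : ∑ w ∈ F, lp.single (E := fun _ : (Σ k, RightCosets (N k)) => ℝ) 1
        ⟨x.1, cosetMul (N x.1) (cosetMul (N x.1) x.2 s) w⟩ (F.card : ℝ)⁻¹ =
        ∑ w ∈ (s : Γ) • F, u w := by
      rw [← Finset.image_smul, Finset.sum_image (by simp)]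
      simp [hu, cosetMul_mul]
    have hcard : (((F \ ((s : Γ) • F)).card : ℝ) + (((s : Γ) • F) \ F).card) < ε * F.card := by
      convert hF s (by simp) using 1
      rw [← Finset.coe_smul_finset, ← Finset.coe_symmDiff, Set.ncard_coe_finset,
        symmDiff_def, Finset.sup_eq_union, Finset.card_union_of_disjoint disjoint_sdiff_sdiff,
        Nat.cast_add, add_comm]
    change ‖∑ w ∈ F, u w - ∑ w ∈ F, _‖ < ε
    -- The terms over `F ∩ s • F` cancel, leaving the symmetric difference.
    rw [hshift, ← Finset.sum_sdiff_sub_sum_sdiff]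
    calc _ ≤ ‖∑ w ∈ F \ ((s : Γ) • F), u w‖ + ‖∑ w ∈ ((s : Γ) • F) \ F, u w‖ := norm_sub_le _ _
      _ ≤ (F \ ((s : Γ) • F)).card * (F.card : ℝ)⁻¹ +
          (((s : Γ) • F) \ F).card * (F.card : ℝ)⁻¹ := by
        refine add_le_add ?_ ?_ <;>
        · rw [← nsmul_eq_mul]
          exact (norm_sum_le _ _).trans (Finset.sum_le_card_nsmul _ _ _ fun w _ => hu1 w)
      _ < ε := by
        rw [← add_mul, ← div_eq_mul_inv, div_lt_iff₀ hFpos]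
        exact hcard

end PropertyA

/-! ### From property A to hyperfiniteness. -/

section Hyperfinite

variable {Γ : Type*} [Group Γ]

theorem finite_rightCosets (Λ : Subgroup Γ) [Λ.FiniteIndex] : Finite (RightCosets Λ) :=
  .of_equiv _ (QuotientGroup.quotientRightRelEquivQuotientLeftRel Λ).symm

/-- A function that is constant along the edges outside `E` is constant on the connected components
of the graph with `E` removed. -/
theorem eq_of_reachable_deleteEdges {V L α : Type*} (G : LabelledGraph V L) (E : Set (V × L × V))
    (p : V → α) (hp : ∀ s x y, G.Adj s x y → (x, s, y) ∉ E → p x = p y) {x y : V}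
    (h : (G.deleteEdges E).toSimpleGraph.Reachable x y) : p x = p y := by
  obtain ⟨w⟩ := h
  induction w with
  | nil => rfl
  | cons hadj _ ih =>
    obtain ⟨-, ⟨s, hs, hE⟩ | ⟨s, hs, hE⟩⟩ := (SimpleGraph.fromRel_adj _ _ _).1 hadj
    · exact (hp _ _ _ hs hE).trans ih
    · exact (hp _ _ _ hs hE).symm.trans ih

/-- Eventually some ball is a copy of a Cayley ball containing `n` prescribed elements. This growth
makes the rounded edge densities converge below. -/
theorem tendsto_card_rightCosets [Infinite Γ] {S : Set Γ} (hSgen : Subgroup.closure S = ⊤)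
    {N : ℕ → Subgroup Γ} (hN : IsFarberSequence S N) :
    Tendsto (fun k => Nat.card (RightCosets (N k))) atTop atTop := by
  refine tendsto_atTop.2 fun n => ?_
  obtain ⟨F, -, hF⟩ := (Set.infinite_univ (α := Γ)).exists_subset_card_eq n
  choose r hr using exists_edist_cayleyGraph_le S hSgen
  filter_upwards [(hN.2 (F.sup r)).eventually (lt_mem_nhds zero_lt_one)] with k hk
  have := hN.1 k
  have := finite_rightCosets (N k)
  obtain ⟨x, e, -, -⟩ : Nonempty {x // BallIso (schreierGraph (N k) S) x (cayleyGraph S) 1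
      (F.sup r)} := by
    by_contra hne
    rw [not_nonempty_iff] at hne
    simp [ballProb] at hk
  have hmem : ∀ w : F, (w : Γ) ∈ (cayleyGraph S).ball 1 (F.sup r) := fun w =>
    (hr w).trans (by exact_mod_cast Finset.le_sup w.2)
  rw [← hF, ← Nat.card_eq_finsetCard]
  refine Nat.card_le_card_of_injective (fun w : F => (e.symm ⟨w, hmem w⟩ : RightCosets (N k))) ?_
  intro v w hvw
  have h := e.symm.injective (Subtype.ext hvw)
  exact Subtype.ext (Subtype.mk.inj h)

open Classical in
/-- The set of edges of a finite Schreier graph. -/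
noncomputable def schreierEdges (Λ : Subgroup Γ) (S : Set Γ) [Fintype S]
    [Fintype (RightCosets Λ)] : Finset (RightCosets Λ × S × RightCosets Λ) :=
  (Finset.univ : Finset (RightCosets Λ × S)).image fun q => (q.1, q.2, cosetMul Λ q.1 q.2)

theorem mem_schreierEdges {Λ : Subgroup Γ} {S : Set Γ} [Fintype S] [Fintype (RightCosets Λ)]
    {e : RightCosets Λ × S × RightCosets Λ} :
    e ∈ schreierEdges Λ S ↔ e.2.2 = cosetMul Λ e.1 e.2.1 := by
  obtain ⟨x, s, y⟩ := e
  simp [schreierEdges, eq_comm]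

theorem card_schreierEdges (Λ : Subgroup Γ) (S : Set Γ) [Fintype S] [Fintype (RightCosets Λ)] :
    (schreierEdges Λ S).card = Fintype.card (RightCosets Λ) * Fintype.card S := by
  classical
  rw [schreierEdges, Finset.card_image_of_injective, Finset.card_univ, Fintype.card_prod]
  rintro ⟨x, s⟩ ⟨y, t⟩ h
  simp only [Prod.mk.injEq] at h ⊢
  exact ⟨h.1, h.2.1⟩

open Classical in
theorem card_filter_schreierEdges_le (Λ : Subgroup Γ) (S : Set Γ) [Fintype S]
    [Fintype (RightCosets Λ)] (X : Finset (RightCosets Λ)) :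
    ((schreierEdges Λ S).filter fun e => e.1 ∈ X).card ≤ Fintype.card S * X.card := by
  calc _ ≤ ((X ×ˢ (Finset.univ : Finset S)).image
        fun q => (q.1, q.2, cosetMul Λ q.1 q.2)).card := by
        refine Finset.card_le_card fun e he => ?_
        obtain ⟨x, s, y⟩ := e
        simp only [Finset.mem_filter, mem_schreierEdges] at he
        obtain ⟨rfl, hx⟩ := he
        exact Finset.mem_image.2 ⟨(x, s), by simpa using hx, rfl⟩
    _ ≤ _ := Finset.card_image_le
    _ = _ := by rw [Finset.card_product, Finset.card_univ, mul_comm]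

theorem isHyperfinite_schreierGraph_of_finite [Finite Γ] (S : Set Γ) (N : ℕ → Subgroup Γ) :
    IsHyperfinite fun k => schreierGraph (N k) S := by
  intro ε hε
  refine ⟨Nat.card Γ, Nat.card_pos, fun _ => ∅, fun _ => Set.empty_subset _,
    ⟨0, hε, by simp⟩, fun k C => ?_⟩
  have h : (Nat.card (RightCosets (N k)) : ℕ∞) ≤ Nat.card Γ := by
    exact_mod_cast Nat.card_le_card_of_surjective _ Quotient.mk_surjective
  refine (Set.encard_le_encard (Set.subset_univ _)).trans (le_trans ?_ h)
  rw [Set.encard_univ, ENat.card_eq_coe_natCard]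

theorem isHyperfinite_of_hasPropertyA {S : Set Γ} (hSfin : S.Finite)
    (hSgen : Subgroup.closure S = ⊤) {N : ℕ → Subgroup Γ} (hN : IsFarberSequence S N)
    (hA : HasPropertyA fun k => schreierGraph (N k) S) :
    IsHyperfinite fun k => schreierGraph (N k) S := by
  classical
  -- For finite `Γ` the vertex numbers stay bounded and no edge need be removed.
  rcases finite_or_infinite Γ with hfin | hinf
  · exact isHyperfinite_schreierGraph_of_finite S N
  have hSne : S.Nonempty := by
    rw [Set.nonempty_iff_ne_empty]
    rintro rfl
    rw [Subgroup.closure_empty] at hSgen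
    exact not_subsingleton Γ (Subgroup.subsingleton_iff.1
      (subsingleton_iff_bot_eq_top.1 hSgen))
  have := hSfin.fintype
  have : ∀ k, (N k).FiniteIndex := hN.1
  have : ∀ k, Finite (RightCosets (N k)) := fun k => finite_rightCosets (N k)
  have : ∀ k, Fintype (RightCosets (N k)) := fun k => Fintype.ofFinite _
  intro ε hε
  -- `c` will be the limiting density of removed edges: it is below `ε`, and at most `1` so that
  -- there are enough edges to remove.
  set c : ℝ := min (ε / 2) 1 with hc
  have hcpos : 0 < c := lt_min (by linarith) one_pos
  have hcε : c < ε := (min_le_left _ _).trans_lt (by linarith)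
  set d : ℝ := (Fintype.card S : ℝ) with hd
  have hdnn : 0 ≤ d := Nat.cast_nonneg _
  set δ : ℝ := c / (d + 1) with hδ
  have hδpos : 0 < δ := by positivity
  have hdδ : d * δ < c := by
    rw [hδ, mul_div_assoc', div_lt_iff₀ (by positivity)]
    nlinarith
  obtain ⟨R, -, ξ, hξ1, hξR, hξ⟩ := hA δ hδpos
  obtain ⟨T, hT⟩ := exists_finset_of_mem_ball_disjointUnion N hSfin R
  have hcut : ∀ k, ∃ D ⊆ schreierEdges (N k) S,
      (D.card : ℝ) ≤ c * Fintype.card (RightCosets (N k)) ∧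
      ∃ p : RightCosets (N k) → Finset (RightCosets (N k)),
        (∀ x, x ∈ p x ∧ (p x).card ≤ T.card) ∧
        ∀ e ∈ schreierEdges (N k) S, e ∉ D → p e.1 = p e.2.2 := by
    intro k
    have hinj : Function.Injective (Sigma.mk (β := fun k => RightCosets (N k)) k) :=
      sigma_mk_injective
    have hsmall : ∀ X : Finset (RightCosets (N k)), X.Nonempty → ∃ B ⊆ X, B.Nonempty ∧
        B.card ≤ T.card ∧ ((relBoundary (schreierEdges (N k) S) X B).card : ℝ) ≤ c * B.card := by
      intro X hX
      refine exists_small_relBoundary (d := d) (schreierEdges (N k) S) hδpos.le hdδ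
        (fun x z => ‖ξ ⟨k, x⟩ ⟨k, z⟩‖) (fun _ _ => norm_nonneg _) ?_ ?_ ?_ hX ?_
      · intro x
        have h := hasSum_norm_lp_one (ξ ⟨k, x⟩)
        rw [hξ1, ← hinj.hasSum_iff] at h
        · exact (hasSum_fintype _).unique h
        -- Balls do not leave their member of the disjoint union, so all the mass lies in the `k`-th
        -- graph.
        · intro z hz
          rw [norm_eq_zero]
          by_contra hne
          obtain ⟨w, -, rfl⟩ := hT _ _ (hξR _ _ hne)
          exact hz ⟨_, rfl⟩
      · rintro ⟨x, s, y⟩ he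
        rw [mem_schreierEdges] at he
        have hlt := hξ s ⟨k, x⟩ ⟨k, y⟩ ⟨k, x, y, rfl, rfl, (schreierGraph_adj_iff _ _ _ _ _).2 he⟩
        have h := hasSum_norm_lp_one (ξ ⟨k, x⟩ - ξ ⟨k, y⟩)
        refine le_trans ?_ hlt.le
        refine le_trans (Finset.sum_le_sum fun z _ => abs_norm_sub_norm_le _ _) ?_
        refine le_trans (le_of_eq ?_) (sum_le_hasSum (Finset.univ.map ⟨_, hinj⟩)
          (fun _ _ => norm_nonneg _) h)
        simp
      -- By symmetry of the distance, every `x` with `z` in the support of `ξ x` is a translate of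
      -- `z` by an element of `T`; the bound `T.card` is independent of `k`.
      · intro z
        refine (Finset.card_le_card (t := T.image fun w => cosetMul (N k) z w) fun x hx => ?_).trans
          Finset.card_image_le
        have hne := (Finset.mem_filter.1 hx).2
        have hxz := hξR ⟨k, x⟩ ⟨k, z⟩ fun h => hne (by rw [h, norm_zero])
        obtain ⟨w, hw, hxw⟩ := hT ⟨k, z⟩ ⟨k, x⟩ (by
          simpa only [ball, Set.mem_ofPred_eq, SimpleGraph.edist_comm] using hxz)
        exact Finset.mem_image.2 ⟨w, hw, (hinj hxw).symm⟩
      · rw [hd, ← Nat.cast_mul, Nat.cast_le]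
        convert card_filter_schreierEdges_le (N k) S X
    obtain ⟨D, hDE, hD, p, hp, hpe⟩ := exists_partition_of_small_relBoundary
      (schreierEdges (N k) S) T.card c hsmall Finset.univ
    exact ⟨D, hDE, hD, p, fun x => ⟨(hp x (Finset.mem_univ _)).1, (hp x (Finset.mem_univ _)).2.2⟩,
      fun e he heD => hpe e he heD (Finset.mem_univ _) (Finset.mem_univ _)⟩
  choose D hDE hD p hp hpe using hcut
  -- The densities of `D k` are only bounded by `c`. Enlarging to exactly `⌊c |V|⌋` edges forces
  -- convergence to `c`, and removing more edges does no harm.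
  have hpad : ∀ k, ∃ E, D k ⊆ E ∧ E ⊆ schreierEdges (N k) S ∧
      E.card = ⌊c * (Fintype.card (RightCosets (N k)) : ℝ)⌋₊ := by
    intro k
    refine Finset.exists_subsuperset_card_eq (hDE k) (Nat.le_floor (hD k)) ?_
    rw [card_schreierEdges]
    refine Nat.floor_le_of_le ?_
    have h1 : (1 : ℝ) ≤ Fintype.card S := by
      have : Nonempty S := hSne.to_subtype
      exact_mod_cast Fintype.card_pos (α := S)
    push_cast
    rw [mul_comm]
    exact mul_le_mul_of_nonneg_left ((min_le_right _ _).trans h1) (Nat.cast_nonneg _)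
  choose E hDE' hES hEcard using hpad
  refine ⟨T.card + 1, Nat.succ_pos _, fun k => E k, fun k e he => ?_, ⟨c, hcε, ?_⟩, fun k C => ?_⟩
  · exact (schreierGraph_adj_iff _ _ _ _ _).2 (mem_schreierEdges.1 (hES k he))
  · have hlim := (tendsto_nat_floor_mul_div_atTop hcpos.le).comp
      (tendsto_natCast_atTop_atTop.comp (tendsto_card_rightCosets hSgen hN))
    refine hlim.congr fun k => ?_
    simp [Set.ncard_coe_finset, hEcard]
  · induction C using SimpleGraph.ConnectedComponent.ind with
    | h x =>
    refine (Set.encard_le_encard (t := (p k x : Set (RightCosets (N k)))) fun y hy => ?_).trans ?_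
    · have hreach := SimpleGraph.ConnectedComponent.exact hy
      have := eq_of_reachable_deleteEdges _ _ (p k) (fun s a b hab hE =>
        hpe k (a, s, b) (mem_schreierEdges.2 ((schreierGraph_adj_iff _ _ _ _ _).1 hab))
          fun h => hE (hDE' k h)) hreach
      rw [← this]
      exact (hp k y).1
    · rw [Set.encard_coe_eq_coe_finsetCard]
      exact_mod_cast (hp k x).2.trans (Nat.le_succ _)

end Hyperfinite

/-! ### From hyperfiniteness to Følner sets. -/

section Amenable

variable {Γ : Type*} [Group Γ]

open Classical in
/-- A set that is almost invariant under right multiplication by generators is almost invariant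
under right multiplication by any fixed element. -/
theorem exists_card_filter_mul_notMem_le {S : Set Γ} (hS : Subgroup.closure S = ⊤) (g : Γ) :
    ∃ n : ℕ, ∀ (F : Finset Γ) (t : ℝ), 0 ≤ t →
      (∀ s ∈ S, ((F.filter fun a => a * s ∉ F).card : ℝ) ≤ t) →
        ((F.filter fun a => a * g ∉ F).card : ℝ) ≤ n * t := by
  have hg : g ∈ Subgroup.closure S := hS ▸ Subgroup.mem_top g
  induction hg using Subgroup.closure_induction with
  | mem s hs => exact ⟨1, fun F t _ h => by simpa using h s hs⟩
  | one => exact ⟨0, fun F t _ h => by simp⟩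
  | mul g h _ _ ihg ihh =>
    obtain ⟨m, hm⟩ := ihg
    obtain ⟨n, hn⟩ := ihh
    refine ⟨m + n, fun F t ht hF => ?_⟩
    have hsub : (F.filter fun a => a * (g * h) ∉ F) ⊆ (F.filter fun a => a * g ∉ F) ∪
        (F.filter fun b => b * h ∉ F).image (· * g⁻¹) := by
      intro a ha
      rw [Finset.mem_filter] at ha
      rw [Finset.mem_union, Finset.mem_filter, Finset.mem_image]
      by_cases hag : a * g ∈ F
      · exact Or.inr ⟨a * g, Finset.mem_filter.2 ⟨hag, by simpa [mul_assoc] using ha.2⟩, by simp⟩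
      · exact Or.inl ⟨ha.1, hag⟩
    have hcard : ((F.filter fun a => a * (g * h) ∉ F).card : ℝ) ≤
        (F.filter fun a => a * g ∉ F).card + (F.filter fun b => b * h ∉ F).card := by
      exact_mod_cast (Finset.card_le_card hsub).trans ((Finset.card_union_le _ _).trans
        (Nat.add_le_add_left Finset.card_image_le _))
    push_cast
    linarith [hm F t ht hF, hn F t ht hF]
  | inv g _ ih =>
    obtain ⟨m, hm⟩ := ih
    refine ⟨m, fun F t ht hF => le_trans ?_ (hm F t ht hF)⟩
    have h1 := Finset.card_filter_add_card_filter_not (s := F) (fun a => a * g⁻¹ ∈ F)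
    have h2 := Finset.card_filter_add_card_filter_not (s := F) (fun a => a * g ∈ F)
    -- As many points stay in `F` under `g⁻¹` as under `g`, hence as many leave.
    have h3 : (F.filter fun a => a * g⁻¹ ∈ F).card = (F.filter fun a => a * g ∈ F).card :=
      Finset.card_bij' (fun a _ => a * g⁻¹) (fun a _ => a * g)
        (by simp +contextual) (by simp +contextual) (by simp) (by simp)
    exact_mod_cast (by omega :
      (F.filter fun a => a * g⁻¹ ∉ F).card ≤ (F.filter fun a => a * g ∉ F).card)

open Classical in
/-- Amenability follows from the existence of right Følner sets for a generating set. -/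
theorem isAmenable_of_right_folner {S : Set Γ} (hS : Subgroup.closure S = ⊤)
    (h : ∀ δ : ℝ, 0 < δ → ∃ F : Finset Γ, F.Nonempty ∧
      ∀ s ∈ S, ((F.filter fun a => a * s ∉ F).card : ℝ) ≤ δ * F.card) :
    IsAmenable Γ := by
  intro A ε hε
  choose n hn using exists_card_filter_mul_notMem_le hS
  set M : ℕ := A.sup fun g => n g + n g⁻¹ with hM
  set δ : ℝ := ε / (M + 1) with hδ
  have hδpos : 0 < δ := by positivity
  obtain ⟨F, hFne, hF⟩ := h δ hδpos
  have hFpos : (0 : ℝ) < F.card := by exact_mod_cast hFne.card_pos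
  -- Inversion exchanges right and left translation; the two halves of the symmetric difference cost
  -- `n g⁻¹` and `n g`.
  refine ⟨F⁻¹, hFne.inv, fun g hg => ?_⟩
  rw [← Finset.coe_smul_finset, ← Finset.coe_symmDiff, Set.ncard_coe_finset, Finset.card_inv]
  have hsub : (g • F⁻¹) ∆ F⁻¹ ⊆ ((F.filter fun a => a * g⁻¹ ∉ F).image fun a => g * a⁻¹) ∪
      (F.filter fun a => a * g ∉ F).image fun a => a⁻¹ := by
    intro b hb
    rw [Finset.mem_union, Finset.mem_image, Finset.mem_image]
    rw [Finset.mem_symmDiff, ← Finset.inv_smul_mem_iff, Finset.mem_inv',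
      Finset.mem_inv', smul_eq_mul, mul_inv_rev, inv_inv] at hb
    rcases hb with ⟨h1, h2⟩ | ⟨h1, h2⟩
    · exact Or.inl ⟨b⁻¹ * g, Finset.mem_filter.2 ⟨h1, by simpa using h2⟩, by simp⟩
    · exact Or.inr ⟨b⁻¹, Finset.mem_filter.2 ⟨h1, h2⟩, by simp⟩
  have hcard : ((((g • F⁻¹) ∆ F⁻¹).card : ℕ) : ℝ) ≤
      (F.filter fun a => a * g⁻¹ ∉ F).card + (F.filter fun a => a * g ∉ F).card := by
    exact_mod_cast (Finset.card_le_card hsub).trans ((Finset.card_union_le _ _).trans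
      (Nat.add_le_add Finset.card_image_le Finset.card_image_le))
  have ht : 0 ≤ δ * F.card := by positivity
  have hle : ((n g : ℝ) + n g⁻¹) ≤ M := by
    exact_mod_cast Finset.le_sup (f := fun g => n g + n g⁻¹) hg
  calc _ ≤ _ := hcard
    _ ≤ n g⁻¹ * (δ * F.card) + n g * (δ * F.card) :=
      add_le_add (hn _ F _ ht hF) (hn _ F _ ht hF)
    _ = (n g + n g⁻¹) * (δ * F.card) := by ring
    _ ≤ M * (δ * F.card) := mul_le_mul_of_nonneg_right hle ht
    _ < (M + 1) * (δ * F.card) := by nlinarith [mul_pos hδpos hFpos]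
    _ = ε * F.card := by
      rw [hδ]
      field_simp

/-- A connected component with at most `K` vertices is contained in the `K`-ball around any of its
vertices. -/
theorem edist_le_of_encard_supp_le {V : Type*} (G : SimpleGraph V) {K : ℕ} {x y : V}
    (hK : (G.connectedComponentMk x).supp.encard ≤ K) (h : G.Reachable x y) :
    G.edist x y ≤ K := by
  classical
  obtain ⟨p, hp⟩ := h.exists_isPath
  refine (SimpleGraph.edist_le p).trans (le_trans ?_ hK)
  have hsub : (p.support.toFinset : Set V) ⊆ (G.connectedComponentMk x).supp := by
    intro z hz
    have hz' : z ∈ p.support := by simpa using hz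
    exact SimpleGraph.ConnectedComponent.sound (p.takeUntil z hz').reachable.symm
  refine le_trans ?_ (Set.encard_le_encard hsub)
  rw [Set.encard_coe_eq_coe_finsetCard, List.toFinset_card_of_nodup hp.support_nodup,
    SimpleGraph.Walk.length_support]
  exact_mod_cast Nat.le_succ _

open Classical in
/-- If fewer than `δ |V| / 2` edges are given, and at least half of the vertices are good, then
there is a good vertex in whose class the number of edges starting there is at most `δ` times
the size of the class. -/
theorem exists_class_card_edges_le {V W : Type*} [Fintype V] (r : Setoid V) (D : Finset W)
    (src : W → V) (P : V → Prop) {δ : ℝ} (hδ : 0 ≤ δ)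
    (hP : (Fintype.card V : ℝ) / 2 ≤ (Finset.univ.filter P).card)
    (hD : (D.card : ℝ) < δ * (Fintype.card V / 2)) :
    ∃ x, P x ∧ ((D.filter fun e => r (src e) x).card : ℝ) ≤
      δ * (Finset.univ.filter fun y => r y x).card := by
  by_contra! hcon
  have hpos : ∀ x, (0 : ℝ) < (Finset.univ.filter fun y => r y x).card := fun x => by
    exact_mod_cast Finset.card_pos.2 ⟨x, by simp⟩
  have h1 : δ * (Finset.univ.filter P).card ≤
      ∑ x, ((D.filter fun e => r (src e) x).card : ℝ) /
        (Finset.univ.filter fun y => r y x).card := by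
    rw [mul_comm, ← nsmul_eq_mul]
    refine (Finset.card_nsmul_le_sum _ _ δ fun x hx => ?_).trans
      (Finset.sum_le_sum_of_subset_of_nonneg (Finset.filter_subset P _)
        fun _ _ _ => by positivity)
    rw [le_div_iff₀ (hpos x)]
    exact (hcon x (Finset.mem_filter.1 hx).2).le
  -- Double counting: an edge contributes the inverse class size at each vertex of the class of its
  -- source, in total `1`.
  have h2 : ∑ x, ((D.filter fun e => r (src e) x).card : ℝ) /
      (Finset.univ.filter fun y => r y x).card = D.card := by
    have : ∀ x, ((D.filter fun e => r (src e) x).card : ℝ) /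
        (Finset.univ.filter fun y => r y x).card = ∑ e ∈ D, if r x (src e) then
          ((Finset.univ.filter fun y => r y (src e)).card : ℝ)⁻¹ else 0 := by
      intro x
      rw [← Finset.sum_filter, div_eq_mul_inv, ← nsmul_eq_mul, ← Finset.sum_const]
      refine Finset.sum_congr (Finset.filter_congr fun e _ => ⟨r.symm, r.symm⟩) fun e he => ?_
      have hex := (Finset.mem_filter.1 he).2
      congr 3
      exact Finset.filter_congr fun y _ =>
        ⟨fun h => r.trans h hex, fun h => r.trans h (r.symm hex)⟩
    rw [Finset.sum_congr rfl fun x _ => this x, Finset.sum_comm]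
    refine (Finset.sum_congr rfl fun e _ => ?_).trans (by simp : ∑ e ∈ D, (1 : ℝ) = D.card)
    rw [← Finset.sum_filter, Finset.sum_const, nsmul_eq_mul, mul_inv_cancel₀ (hpos _).ne']
  have := mul_le_mul_of_nonneg_left hP hδ
  linarith

theorem isAmenable_of_isHyperfinite {S : Set Γ} (hSfin : S.Finite)
    (hSgen : Subgroup.closure S = ⊤) {N : ℕ → Subgroup Γ} (hN : IsFarberSequence S N)
    (hH : IsHyperfinite fun k => schreierGraph (N k) S) : IsAmenable Γ := by
  classical
  refine isAmenable_of_right_folner hSgen fun δ hδ => ?_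
  -- The factor `1 / 2` compensates for only half of the vertices being known to be good. Radius `K`
  -- suffices because a component with at most `K` vertices lies in the `K`-ball about each of them.
  obtain ⟨K, -, E, hE, ⟨l, hl, hlim⟩, hK⟩ := hH (δ / 2) (by linarith)
  obtain ⟨k, hkE, hkP⟩ := ((hlim.eventually (gt_mem_nhds hl)).and
    ((hN.2 K).eventually (lt_mem_nhds (by norm_num : (1 / 2 : ℝ) < 1)))).exists
  have := hSfin.fintype
  have := hN.1 k
  have := finite_rightCosets (N k)
  have := Fintype.ofFinite (RightCosets (N k))
  have hVpos : (0 : ℝ) < Fintype.card (RightCosets (N k)) := by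
    have : Nonempty (RightCosets (N k)) := ⟨rightCoset _ 1⟩
    exact_mod_cast Fintype.card_pos (α := RightCosets (N k))
  set G := schreierGraph (N k) S
  set H := (G.deleteEdges (E k)).toSimpleGraph with hHdef
  set D : Finset (RightCosets (N k) × S × RightCosets (N k)) := (E k).toFinset with hDdef
  obtain ⟨x, ⟨e, -, he⟩, hx⟩ := exists_class_card_edges_le H.reachableSetoid D Prod.fst
    (fun x => BallIso G x (cayleyGraph S) 1 K) hδ.le
    (by
      rw [ballProb, lt_div_iff₀ (by rwa [Nat.card_eq_fintype_card]), Nat.card_eq_fintype_card,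
        Nat.card_eq_fintype_card, Fintype.card_subtype] at hkP
      linarith)
    (by
      rw [div_lt_iff₀ (by rwa [Nat.card_eq_fintype_card]), Nat.card_eq_fintype_card,
        Set.ncard_eq_toFinset_card'] at hkE
      linarith)
  set C : Finset (RightCosets (N k)) := Finset.univ.filter fun y => H.reachableSetoid y x with hC
  have hmemC : ∀ y, y ∈ C ↔ H.Reachable y x := fun y => by
    rw [hC, Finset.mem_filter]
    exact and_iff_right (Finset.mem_univ _)
  have hHG : H ≤ G.toSimpleGraph := by
    intro a b hab
    rw [hHdef, toSimpleGraph, SimpleGraph.fromRel_adj] at hab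
    rw [toSimpleGraph, SimpleGraph.fromRel_adj]
    exact ⟨hab.1, hab.2.imp (fun ⟨s, h⟩ => ⟨s, h.1⟩) (fun ⟨s, h⟩ => ⟨s, h.1⟩)⟩
  have hball : ∀ y ∈ C, y ∈ G.ball x K := fun y hy =>
    (SimpleGraph.edist_anti hHG).trans
      (edist_le_of_encard_supp_le H (hK k _) ((hmemC y).1 hy).symm)
  set φ : C → Γ := fun c => e ⟨c, hball c c.2⟩ with hφ
  have hφinj : Function.Injective φ := by
    intro a b hab
    have := e.injective (Subtype.ext hab)
    exact Subtype.ext (Subtype.mk.inj this)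
  have hFcard : (Finset.univ.image φ).card = C.card := by
    rw [Finset.card_image_of_injective _ hφinj, Finset.card_univ, Fintype.card_coe]
  refine ⟨Finset.univ.image φ, ⟨φ ⟨x, (hmemC x).2 (SimpleGraph.Reachable.refl x)⟩, by simp⟩,
    fun s hs => ?_⟩
  rw [hFcard]
  refine le_trans ?_ hx
  -- If the `s`-edge at `c` survived, its endpoint would lie in `C`, hence in the ball, and the
  -- isomorphism would map it to `φ c * s`.
  have hesc : ∀ c : C, φ c * s ∉ Finset.univ.image φ →
      ((c : RightCosets (N k)), (⟨s, hs⟩ : S), cosetMul (N k) c s) ∈ E k := by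
    intro c hc
    by_contra hcE
    have hadj : G.Adj ⟨s, hs⟩ c (cosetMul (N k) c s) := (schreierGraph_adj_iff _ _ _ _ _).2 rfl
    have hcC : cosetMul (N k) c s ∈ C := by
      rw [hmemC]
      refine SimpleGraph.Reachable.trans ?_ ((hmemC c).1 c.2)
      by_cases hne : (c : RightCosets (N k)) = cosetMul (N k) c s
      · rw [← hne]
      · exact (SimpleGraph.Adj.reachable
          ((SimpleGraph.fromRel_adj _ _ _).2 ⟨hne, Or.inl ⟨⟨s, hs⟩, hadj, hcE⟩⟩)).symm
    refine hc (Finset.mem_image.2 ⟨⟨_, hcC⟩, Finset.mem_univ _, ?_⟩)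
    exact (he ⟨s, hs⟩ ⟨c, hball c c.2⟩ ⟨_, hball _ hcC⟩).1 hadj
  have hcount : ((Finset.univ.image φ).filter fun a => a * s ∉ Finset.univ.image φ) ⊆
      ((Finset.univ.filter fun c : C => φ c * s ∉ Finset.univ.image φ)).image φ := by
    intro a ha
    rw [Finset.mem_filter] at ha
    obtain ⟨ha, has⟩ := ha
    obtain ⟨c, -, rfl⟩ := Finset.mem_image.1 ha
    exact Finset.mem_image_of_mem φ (Finset.mem_filter.2 ⟨Finset.mem_univ _, has⟩)
  refine Nat.cast_le.2 (((Finset.card_le_card hcount).trans Finset.card_image_le).trans ?_)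
  -- For fixed `s`, an edge is determined by its source, so escaping points inject into the removed
  -- edges starting in `C`.
  refine Finset.card_le_card_of_injOn
    (fun c : C => ((c : RightCosets (N k)), (⟨s, hs⟩ : S), cosetMul (N k) c s)) ?_ ?_
  · intro c hc
    have hc' := (Finset.mem_filter.1 hc).2
    refine Finset.mem_filter.2 ⟨Set.mem_toFinset.2 (hesc c hc'), ?_⟩
    exact (hmemC c).1 c.2
  · intro a _ b _ hab
    exact Subtype.ext (congrArg Prod.fst hab)

end Amenable

end FarberElek

theorem mainTheorem6 {Γ : Type*} [Group Γ] (S : Set Γ) (hSfin : S.Finite)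
    (hSgen : Subgroup.closure S = ⊤) (N : ℕ → Subgroup Γ)
    (hN : FarberElek.IsFarberSequence S N) :
    List.TFAE [
      FarberElek.IsAmenable Γ,
      FarberElek.HasPropertyA (fun k => FarberElek.schreierGraph (N k) S),
      FarberElek.IsHyperfinite (fun k => FarberElek.schreierGraph (N k) S)] := by
  tfae_have 1 → 2 := FarberElek.hasPropertyA_of_isAmenable hSfin hSgen N
  tfae_have 2 → 3 := FarberElek.isHyperfinite_of_hasPropertyA hSfin hSgen hN
  tfae_have 3 → 1 := FarberElek.isAmenable_of_isHyperfinite hSfin hSgen hN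
  tfae_finish
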